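/- Let $\mathbf Z=(z_k)_{k\in\mathbb N}$ be a sequence of pairwise different complex numbers with $\lim_{k\to\infty}|z_k|=\infty$, let $f:\mathbb C\to\mathbb C$ be a Weierstrass function associated to $\mathbf Z$, that is, an entire function whose zeros are exactly the points $z_k$, all of them simple, and let $m\ge 2$ be an integer. Let $S(f,m)=\{(z,w)\in\mathbb C^2: w^m=f(z)\}$ be the infinite hyperelliptic curve, with the tame translation structure lifted from $\mathbb C$ by the projection $(z,w)\mapsto z$; its cone points are the points $(z_k,0)$. Its Veech group $\Gamma(S(f,m))\le \mathrm{GL}_+(2,\mathbb R)$ is the group of differentials of the orientation preserving affine diffeomorphisms of $S(f,m)$, that is, of the homeomorphisms of $S(f,m)$ onto itself that preserve the set of cone points and are affine maps in the translation charts. Let $\mathrm{Hol}\subset\mathbb C$ be the set of holonomy vectors $\pm v$ of all saddle connections of $S(f,m)$, and identify $\mathbb C$ with $\mathbb R^2$ by sending $1,i$ to the standard basis. Then $\Gamma(S(f,m))$ is an uncountable proper subgroup of $\mathrm{GL}_+(2,\mathbb R)$ if and only if all points of $\mathbf Z$ are collinear (over $\mathbb R$). Moreover: (a) If all points of $\mathbf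 Z$ are collinear, then there is $\theta\in\mathbb R$ such that $R_\theta^{-1}PR_\theta\subseteq\Gamma(S(f,m))$, where $R_\theta$ is the rotation by the angle $\theta$ and $P=\left\{\begin{pmatrix}1&t\\0&s\end{pmatrix}: t\in\mathbb R,\ s>0\right\}$. (b) If the points of $\mathbf Z$ are not collinear, then $\mathrm{Hol}\times\mathrm{Hol}$ is countable, $\mathrm{Hol}$ contains two vectors that are linearly independent over $\mathbb R$, and for any two linearly independent $u,v\in\mathrm{Hol}$ the map $A\mapsto (A\cdot u,A\cdot v)$ is an injection of $\Gamma(S(f,m))$ into $\mathrm{Hol}\times\mathrm{Hol}$. -/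

import Mathlib

open Set Filter Topology

noncomputable section

/-- The real linear action `z ↦ A · z` of a matrix on `ℂ = ℝ²`, where `1, i` is the standard
basis. -/
def matAct (A : Matrix (Fin 2) (Fin 2) ℝ) : ℂ →ₗ[ℝ] ℂ :=
  Matrix.toLin Complex.basisOneI Complex.basisOneI A

lemma matAct_one (z : ℂ) : matAct 1 z = z := by
  simp [matAct]

lemma matAct_mul (A B : Matrix (Fin 2) (Fin 2) ℝ) (z : ℂ) :
    matAct (A * B) z = matAct A (matAct B z) := by
  simp [matAct, Matrix.toLin_mul Complex.basisOneI Complex.basisOneI Complex.basisOneI]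

/-- The underlying real matrix of an element of `GL₊(2, ℝ)`. -/
abbrev glMat (g : Matrix.GLPos (Fin 2) ℝ) : Matrix (Fin 2) (Fin 2) ℝ :=
  ((g : Matrix.GeneralLinearGroup (Fin 2) ℝ) : Matrix (Fin 2) (Fin 2) ℝ)

/-! A surface with a translation structure away from cone points -/

/-- A translation structure on a space `X`: a set `cone` of cone points, and an atlas on the
complement of `cone` with values in `ℂ` whose transition maps are locally translations.
The points of `cone` belong to `X`: the space `X` plays the role of the surface completed by its
cone points. -/
structure TranslationStructure (X : Type*) [TopologicalSpace X] where
  /-- the cone points -/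
  cone : Set X
  /-- the charts -/
  atlas : Set (OpenPartialHomeomorph X ℂ)
  source_subset : ∀ φ ∈ atlas, φ.source ⊆ coneᶜ
  exists_chart : ∀ x ∉ cone, ∃ φ ∈ atlas, x ∈ φ.source
  transition : ∀ φ ∈ atlas, ∀ ψ ∈ atlas, ∀ x ∈ φ.source ∩ ψ.source,
    ∃ b : ℂ, ∀ᶠ y in 𝓝 x, ψ y = φ y + b

namespace TranslationStructure

variable {X : Type*} [TopologicalSpace X] (T : TranslationStructure X)

/-- In the charts of `T` around `x` and around `h x`, the map `h` is near `x` an affine map with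
linear part (that is, differential) `A`. -/
def IsAffineAt (h : X → X) (A : Matrix.GLPos (Fin 2) ℝ) (x : X) : Prop :=
  ∀ φ ∈ T.atlas, ∀ ψ ∈ T.atlas, x ∈ φ.source → h x ∈ ψ.source →
    ∃ b : ℂ, ∀ᶠ y in 𝓝 x, ψ (h y) = matAct (glMat A) (φ y) + b

/-- The orientation preserving affine diffeomorphisms: the homeomorphisms of the surface
(cone points included) that map cone points to cone points (and other points to other points) and
that are affine maps of positive determinant in the charts. -/
def affPlus : Set (X ≃ₜ X) :=
  {h | (∀ x, h x ∈ T.cone ↔ x ∈ T.cone) ∧ ∀ x ∉ T.cone, ∃ A, T.IsAffineAt h A x}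

lemma IsAffineAt.comp {h k : X ≃ₜ X} {A B : Matrix.GLPos (Fin 2) ℝ} {x : X}
    (hkx : k x ∉ T.cone) (hA : T.IsAffineAt h A (k x)) (hB : T.IsAffineAt k B x) :
    T.IsAffineAt (k.trans h) (A * B) x := by
  intro φ hφ ψ hψ hx hx'
  obtain ⟨χ, hχ, hkχ⟩ := T.exists_chart _ hkx
  obtain ⟨a, ha⟩ := hA χ hχ ψ hψ hkχ hx'
  obtain ⟨b, hb⟩ := hB φ hφ χ hχ hx hkχ
  refine ⟨matAct (glMat A) b + a, ?_⟩
  filter_upwards [hb, k.continuous.continuousAt.eventually ha] with y h1 h2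
  have h3 : glMat (A * B) = glMat A * glMat B := by simp [glMat]
  rw [Homeomorph.trans_apply, h2, h1, h3, matAct_mul, map_add, add_assoc]

lemma IsAffineAt.symm {h : X ≃ₜ X} {A : Matrix.GLPos (Fin 2) ℝ} {x : X}
    (hA : T.IsAffineAt h A (h.symm x)) : T.IsAffineAt h.symm A⁻¹ x := by
  intro φ hφ ψ hψ hx hx'
  obtain ⟨a, ha⟩ := hA ψ hψ φ hφ hx' (by simpa using hx)
  refine ⟨-matAct (glMat A⁻¹) a, ?_⟩
  filter_upwards [h.symm.continuous.continuousAt.eventually ha] with y h1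
  have h3 : glMat A⁻¹ * glMat A = 1 := by
    have : glMat (A⁻¹ * A) = glMat A⁻¹ * glMat A := by simp only [glMat]; rfl
    rw [← this, inv_mul_cancel]; rfl
  rw [Homeomorph.apply_symm_apply] at h1
  rw [h1, map_add, ← matAct_mul, h3, matAct_one]
  ring

/-- The Veech group: all differentials of orientation preserving affine diffeomorphisms. -/
def veechGroup : Subgroup (Matrix.GLPos (Fin 2) ℝ) where
  carrier := {A | ∃ h ∈ T.affPlus, ∀ x ∉ T.cone, T.IsAffineAt h A x}
  mul_mem' := by
    rintro A B ⟨h, ⟨hc, -⟩, hA⟩ ⟨k, ⟨kc, -⟩, kB⟩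
    have key : ∀ x ∉ T.cone, T.IsAffineAt (k.trans h) (A * B) x := fun x hx =>
      have hk : k x ∉ T.cone := fun H => hx ((kc x).1 H)
      IsAffineAt.comp T hk (hA _ hk) (kB x hx)
    exact ⟨k.trans h, ⟨fun x => (hc _).trans (kc x), fun x hx => ⟨_, key x hx⟩⟩, key⟩
  one_mem' := by
    have key : ∀ x ∉ T.cone, T.IsAffineAt (Homeomorph.refl X) 1 x := by
      intro x _ φ hφ ψ hψ h1 h2
      obtain ⟨b, hb⟩ := T.transition φ hφ ψ hψ x ⟨h1, h2⟩
      refine ⟨b, hb.mono fun y hy => ?_⟩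
      have h3 : glMat 1 = 1 := rfl
      rw [h3, matAct_one]
      exact hy
    exact ⟨Homeomorph.refl X, ⟨fun x => Iff.rfl, fun x hx => ⟨1, key x hx⟩⟩, key⟩
  inv_mem' := by
    rintro A ⟨h, ⟨hc, -⟩, hA⟩
    have hc' : ∀ x, h.symm x ∈ T.cone ↔ x ∈ T.cone := fun x => by
      rw [← hc, Homeomorph.apply_symm_apply]
    have key : ∀ x ∉ T.cone, T.IsAffineAt h.symm A⁻¹ x := fun x hx =>
      IsAffineAt.symm T (hA _ fun H => hx ((hc' x).1 H))
    exact ⟨h.symm, ⟨hc', fun x hx => ⟨_, key x hx⟩⟩, key⟩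

/-- `γ`, restricted to `[0, 1]`, is a saddle connection, parametrized with constant velocity
`v ∈ ℂ`: it joins two cone points, has no cone point in its interior, and is in the charts a
straight line run through with velocity `v`. Its length is `‖v‖`. -/
structure IsSaddleConnection (γ : ℝ → X) (v : ℂ) : Prop where
  continuousOn : ContinuousOn γ (Icc 0 1)
  left_mem : γ 0 ∈ T.cone
  right_mem : γ 1 ∈ T.cone
  interior : ∀ t ∈ Ioo (0 : ℝ) 1, γ t ∉ T.cone
  straight : ∀ t ∈ Ioo (0 : ℝ) 1, ∀ φ ∈ T.atlas, γ t ∈ φ.source →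
    ∀ᶠ s in 𝓝 t, φ (γ s) = φ (γ t) + ((s - t : ℝ) : ℂ) * v

/-- The set `Hol` of holonomy vectors `v, -v` of all saddle connections. -/
def holonomyVectors : Set ℂ :=
  {u | ∃ γ v, T.IsSaddleConnection γ v ∧ (u = v ∨ u = -v)}

end TranslationStructure

/-! Infinite hyperelliptic curves -/

/-- `f` is a Weierstrass function associated to the sequence `Z`: an entire function whose zeros
are exactly the terms of `Z`, each of them simple. -/
structure IsWeierstrassFunction (f : ℂ → ℂ) (Z : ℕ → ℂ) : Prop where
  differentiable : Differentiable ℂ f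
  zero_iff : ∀ z, f z = 0 ↔ z ∈ range Z
  simple : ∀ k, deriv f (Z k) ≠ 0

/-- The curve `S(f, m) = {(z, w) : w ^ m = f z}`, with the topology induced from `ℂ²`. -/
def HyperellipticCurve (f : ℂ → ℂ) (m : ℕ) : Type :=
  {p : ℂ × ℂ // p.2 ^ m = f p.1}

instance (f : ℂ → ℂ) (m : ℕ) : TopologicalSpace (HyperellipticCurve f m) :=
  inferInstanceAs (TopologicalSpace {p : ℂ × ℂ // p.2 ^ m = f p.1})

namespace HyperellipticCurve

variable {f : ℂ → ℂ} {m : ℕ}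

/-- The projection `(z, w) ↦ z`. -/
def pz (p : HyperellipticCurve f m) : ℂ := p.1.1

/-- The projection `(z, w) ↦ w`. -/
def pw (p : HyperellipticCurve f m) : ℂ := p.1.2

lemma continuous_pz : Continuous (pz : HyperellipticCurve f m → ℂ) :=
  continuous_fst.comp continuous_subtype_val

lemma continuous_pw : Continuous (pw : HyperellipticCurve f m → ℂ) :=
  continuous_snd.comp continuous_subtype_val

lemma pw_pow (p : HyperellipticCurve f m) : pw p ^ m = f (pz p) := p.2

lemma exists_chart (hf : Continuous f) (hm : 2 ≤ m) (p : HyperellipticCurve f m)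
    (hp : pw p ≠ 0) : ∃ φ : OpenPartialHomeomorph (HyperellipticCurve f m) ℂ,
      p ∈ φ.source ∧ (∀ q ∈ φ.source, pw q ≠ 0) ∧ ∀ q ∈ φ.source, φ q = pz q := by
  have hd : HasStrictDerivAt (fun w : ℂ => w ^ m) (m * pw p ^ (m - 1)) (pw p) :=
    hasStrictDerivAt_pow m (pw p)
  have hd0 : (m * pw p ^ (m - 1) : ℂ) ≠ 0 :=
    mul_ne_zero (Nat.cast_ne_zero.2 (by omega)) (pow_ne_zero _ hp)
  let e₀ := (hd.hasStrictFDerivAt_equiv hd0).toOpenPartialHomeomorph (fun w : ℂ => w ^ m)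
  let e := e₀.restrOpen {0}ᶜ isOpen_compl_singleton
  have he : ∀ w, e w = w ^ m := fun w => rfl
  have hpe : pw p ∈ e.source :=
    ⟨(hd.hasStrictFDerivAt_equiv hd0).mem_toOpenPartialHomeomorph_source, hp⟩
  have hright : ∀ z, f z ∈ e.target → e.symm (f z) ^ m = f z := fun z hz => by
    rw [← he, e.right_inv hz]
  have hleft : ∀ q : HyperellipticCurve f m, pw q ∈ e.source → e.symm (f (pz q)) = pw q :=
    fun q hq => by rw [← pw_pow q, ← he, e.left_inv hq]
  classical
  let inv : ℂ → HyperellipticCurve f m := fun z =>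
    if hz : f z ∈ e.target then ⟨(z, e.symm (f z)), hright z hz⟩ else p
  have hinv : ∀ z (hz : f z ∈ e.target), inv z = ⟨(z, e.symm (f z)), hright z hz⟩ :=
    fun z hz => dif_pos hz
  have hmap : ∀ q : HyperellipticCurve f m, pw q ∈ e.source → f (pz q) ∈ e.target := by
    intro q hq
    have h := e.map_source hq
    rwa [he, pw_pow] at h
  refine ⟨{ toFun := pz
            invFun := inv
            source := pw ⁻¹' e.source
            target := f ⁻¹' e.target
            map_source' := fun q hq => hmap q hq
            map_target' := fun z hz => ?_
            left_inv' := fun q hq => ?_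
            right_inv' := fun z hz => ?_
            open_source := e.open_source.preimage continuous_pw
            open_target := e.open_target.preimage hf
            continuousOn_toFun := continuous_pz.continuousOn
            continuousOn_invFun := ?_ }, hpe, fun q hq => hq.2, fun q _ => rfl⟩
  · rw [hinv z hz]
    exact e.map_target hz
  · rw [hinv _ (hmap q hq)]
    exact Subtype.ext (Prod.ext rfl (hleft q hq))
  · rw [hinv z hz]
    rfl
  · refine continuousOn_iff_continuous_domRestrict.2 (Continuous.congr (f := fun z =>
      (⟨(z.1, e.symm (f z.1)), hright z.1 z.2⟩ : HyperellipticCurve f m)) ?_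
      fun z => (hinv z.1 z.2).symm)
    refine Continuous.subtype_mk (continuous_subtype_val.prodMk ?_) _
    exact continuousOn_iff_continuous_domRestrict.1
      (e.continuousOn_symm.comp hf.continuousOn fun z hz => hz)

/-- The translation structure of `S(f, m)`, lifted from `ℂ` by the projection `pz`. The cone points
are the points with `w = 0`, that is, `(z, 0)` with `f z = 0`; the charts are the restrictions of
`pz` to the open sets of other points on which `pz` is a homeomorphism onto an open set.
For an entire `f` with simple zeros, each cone point has the finite angle `2 m π` and the cone
points form a closed discrete set over a closed discrete set of `ℂ`, so that `S(f, m)` is its own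
completion for the flat metric. -/
def translationStructure (f : ℂ → ℂ) (m : ℕ) (hf : Continuous f) (hm : 2 ≤ m) :
    TranslationStructure (HyperellipticCurve f m) where
  cone := {p | pw p = 0}
  atlas := {φ | (∀ q ∈ φ.source, pw q ≠ 0) ∧ ∀ q ∈ φ.source, φ q = pz q}
  source_subset := fun _ hφ q hq => hφ.1 q hq
  exists_chart := fun p hp => by
    obtain ⟨φ, h1, h2, h3⟩ := exists_chart hf hm p hp
    exact ⟨φ, ⟨h2, h3⟩, h1⟩
  transition := fun φ hφ ψ hψ x hx => by
    refine ⟨0, ?_⟩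
    filter_upwards [φ.open_source.mem_nhds hx.1, ψ.open_source.mem_nhds hx.2] with y h1 h2
    rw [hφ.2 y h1, hψ.2 y h2, add_zero]

/-- The Veech group of `S(f, m)`. -/
abbrev veech (f : ℂ → ℂ) (m : ℕ) (hf : Continuous f) (hm : 2 ≤ m) :
    Subgroup (Matrix.GLPos (Fin 2) ℝ) :=
  (translationStructure f m hf hm).veechGroup

/-- The set `Hol(S(f, m))` of holonomy vectors. -/
abbrev hol (f : ℂ → ℂ) (m : ℕ) (hf : Continuous f) (hm : 2 ≤ m) : Set ℂ :=
  (translationStructure f m hf hm).holonomyVectors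

end HyperellipticCurve

/-! The group `P` and the rotations -/

/-- The group `P` of all matrices `(1 t; 0 s)` with `t` real and `s > 0`. -/
def groupP : Subgroup (Matrix.GLPos (Fin 2) ℝ) where
  carrier := {g | ∃ t s : ℝ, 0 < s ∧ glMat g = !![1, t; 0, s]}
  mul_mem' := by
    rintro a b ⟨t, s, hs, ha⟩ ⟨t', s', hs', hb⟩
    refine ⟨t' + t * s', s * s', mul_pos hs hs', ?_⟩
    have h3 : glMat (a * b) = glMat a * glMat b := by simp [glMat]
    rw [h3, ha, hb]
    simp
  one_mem' := ⟨0, 1, one_pos, by simp [glMat, Matrix.one_fin_two]⟩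
  inv_mem' := by
    rintro a ⟨t, s, hs, ha⟩
    refine ⟨-t / s, s⁻¹, inv_pos.2 hs, ?_⟩
    have h3 : glMat a⁻¹ = (glMat a)⁻¹ := by simp [glMat]
    rw [h3, ha]
    refine Matrix.inv_eq_left_inv ?_
    rw [Matrix.mul_fin_two, Matrix.one_fin_two]
    have := hs.ne'
    simp [this]

/-- The rotation `z ↦ e ^ (i θ) z`, as an element of `GL₊(2, ℝ)`. -/
def rotationGL (θ : ℝ) : Matrix.GLPos (Fin 2) ℝ :=
  have hdet : (!![Real.cos θ, -Real.sin θ; Real.sin θ, Real.cos θ]).det = 1 := by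
    rw [Matrix.det_fin_two_of]
    nlinarith [Real.sin_sq_add_cos_sq θ]
  ⟨Matrix.GeneralLinearGroup.mkOfDetNeZero
      !![Real.cos θ, -Real.sin θ; Real.sin θ, Real.cos θ] (by rw [hdet]; exact one_ne_zero), by
    rw [Matrix.mem_glpos]
    change 0 < (!![Real.cos θ, -Real.sin θ; Real.sin θ, Real.cos θ]).det
    rw [hdet]
    exact one_pos⟩

end

/-! Affine homeomorphisms permute saddle connections, so the Veech group acts on `Hol`. By
`exists_sub_of_mem_hol`, holonomy vectors are differences of zeros of `f`, hence countable in number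
and parallel to the line when the zeros are collinear. Conversely, a segment between neighbouring
zeros lifts to a saddle connection (`mem_hol_of_segment`).

If the zeros are not collinear, `Hol` spans the plane; a matrix is determined by the images of two
independent vectors, which lie in a countable set. If they are collinear, the quarter turn does not
preserve `Hol`, so the group is proper. It is large by `mem_veech_of_fix_line`: an affine map `g` of
the plane fixing the line pointwise and preserving its sides is joined to the identity by a
straight-line homotopy that fixes every zero and moves no other point onto a zero. So `(f ∘ g) / f`
is homotopic to `1` in `ℂ \ {0}` off the zeros. It therefore has a continuous logarithm there, hence
an `m`-th root `u`, and `(z, w) ↦ (g z, w * u z)` lifts `g` to the curve. -/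

namespace TranslationStructure

variable {X : Type*} [TopologicalSpace X] (T : TranslationStructure X)

/-- The image of a saddle connection under an affine homeomorphism is a saddle connection. -/
lemma IsSaddleConnection.comp {γ : ℝ → X} {v : ℂ} (hγ : T.IsSaddleConnection γ v) (h : X ≃ₜ X)
    (hc : ∀ x, h x ∈ T.cone ↔ x ∈ T.cone) (A : Matrix.GLPos (Fin 2) ℝ)
    (hA : ∀ x ∉ T.cone, T.IsAffineAt h A x) :
    T.IsSaddleConnection (h ∘ γ) (matAct (glMat A) v) where
  continuousOn := h.continuous.comp_continuousOn hγ.continuousOn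
  left_mem := (hc _).2 hγ.left_mem
  right_mem := (hc _).2 hγ.right_mem
  interior t ht := fun H => hγ.interior t ht ((hc _).1 H)
  straight t ht ψ hψ hx := by
    obtain ⟨φ, hφ, hφx⟩ := T.exists_chart _ (hγ.interior t ht)
    obtain ⟨b, hb⟩ := hA _ (hγ.interior t ht) φ hφ ψ hψ hφx hx
    have hcont : ContinuousAt γ t := hγ.continuousOn.continuousAt (Icc_mem_nhds ht.1 ht.2)
    have h0 := hb.self_of_nhds
    filter_upwards [hγ.straight t ht φ hφ hφx, hcont.eventually hb] with s h1 h2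
    simp only [Function.comp_apply]
    rw [h2, h0, h1, map_add, ← Complex.real_smul, map_smul, Complex.real_smul]
    ring

/-- The obstruction to membership in the Veech group: it rules out the quarter turn for collinear
zeros and gives countability otherwise. -/
lemma matAct_mem_holonomyVectors {A : Matrix.GLPos (Fin 2) ℝ} (hA : A ∈ T.veechGroup) {u : ℂ}
    (hu : u ∈ T.holonomyVectors) : matAct (glMat A) u ∈ T.holonomyVectors := by
  obtain ⟨h, ⟨hc, -⟩, hA⟩ := hA
  obtain ⟨γ, v, hγ, huv⟩ := hu
  refine ⟨h ∘ γ, _, hγ.comp T h hc A hA, ?_⟩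
  rcases huv with rfl | rfl
  · exact Or.inl rfl
  · exact Or.inr (map_neg _ _)

end TranslationStructure

/-! ### Linear algebra of the matrix action -/

lemma matAct_apply (A : Matrix (Fin 2) (Fin 2) ℝ) (z : ℂ) :
    matAct A z = ⟨A 0 0 * z.re + A 0 1 * z.im, A 1 0 * z.re + A 1 1 * z.im⟩ := by
  have h : Complex.basisOneI.repr z = ![z.re, z.im] := by
    ext i; simp
  rw [matAct, Matrix.toLin_apply]
  apply Complex.ext <;>
  simp [Matrix.mulVec, Fin.sum_univ_two, dotProduct]

lemma matAct_injective : Function.Injective matAct :=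
  (Matrix.toLin Complex.basisOneI Complex.basisOneI).injective

lemma matAct_glMat_injective :
    Function.Injective fun A : Matrix.GLPos (Fin 2) ℝ => matAct (glMat A) :=
  fun _ _ h => Subtype.ext (Units.ext (matAct_injective h))

lemma continuous_matAct (A : Matrix (Fin 2) (Fin 2) ℝ) : Continuous (matAct A) :=
  LinearMap.continuous_of_finiteDimensional _

lemma matAct_glMat_mul (A B : Matrix.GLPos (Fin 2) ℝ) (z : ℂ) :
    matAct (glMat (A * B)) z = matAct (glMat A) (matAct (glMat B) z) := by
  have h : glMat (A * B) = glMat A * glMat B := by simp [glMat]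
  rw [h, matAct_mul]

lemma matAct_glMat_one (z : ℂ) : matAct (glMat 1) z = z := matAct_one z

lemma matAct_glMat_inv_apply (A : Matrix.GLPos (Fin 2) ℝ) (z : ℂ) :
    matAct (glMat A⁻¹) (matAct (glMat A) z) = z := by
  rw [← matAct_glMat_mul, inv_mul_cancel, matAct_glMat_one]

lemma matAct_glMat_apply_inv (A : Matrix.GLPos (Fin 2) ℝ) (z : ℂ) :
    matAct (glMat A) (matAct (glMat A⁻¹) z) = z := by
  rw [← matAct_glMat_mul, mul_inv_cancel, matAct_glMat_one]

lemma matAct_eq_of_linearIndependent {A B : Matrix (Fin 2) (Fin 2) ℝ} {u v : ℂ}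
    (huv : LinearIndependent ℝ ![u, v]) (hu : matAct A u = matAct B u)
    (hv : matAct A v = matAct B v) : matAct A = matAct B := by
  let b := basisOfLinearIndependentOfCardEqFinrank huv (by simp [Complex.finrank_real_complex])
  refine b.ext fun i => ?_
  fin_cases i <;> simpa [b]

/-- The affine map with linear part `A` and fixed point `c`. -/
noncomputable def affineAbout (A : Matrix.GLPos (Fin 2) ℝ) (c : ℂ) : ℂ ≃ₜ ℂ where
  toFun z := c + matAct (glMat A) (z - c)
  invFun z := c + matAct (glMat A⁻¹) (z - c)
  left_inv z := by simp only [add_sub_cancel_left, matAct_glMat_inv_apply, add_sub_cancel]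
  right_inv z := by simp only [add_sub_cancel_left, matAct_glMat_apply_inv, add_sub_cancel]
  continuous_toFun := by have := continuous_matAct (glMat A); fun_prop
  continuous_invFun := by have := continuous_matAct (glMat A⁻¹); fun_prop

lemma affineAbout_apply (A : Matrix.GLPos (Fin 2) ℝ) (c z : ℂ) :
    affineAbout A c z = c + matAct (glMat A) (z - c) := rfl

/-- A root of a continuous function is continuous at the zeros. -/
lemma continuousAt_of_pow {Y : Type*} [TopologicalSpace Y] {w : Y → ℂ} {m : ℕ} {y : Y}
    (hw : ContinuousAt (fun y => w y ^ m) y) (hy : w y = 0) (hm : m ≠ 0) : ContinuousAt w y := by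
  rw [Metric.continuousAt_iff'] at hw ⊢
  intro ε hε
  filter_upwards [hw (ε ^ m) (pow_pos hε m)] with x hx
  rw [hy, dist_zero_right]
  rw [hy, zero_pow hm, dist_zero_right, norm_pow] at hx
  exact lt_of_pow_lt_pow_left₀ m hε.le hx

/-! ### Lifting affine maps of the plane to the curve -/

namespace HyperellipticCurve

variable {f : ℂ → ℂ} {m : ℕ}

lemma pw_eq_zero_iff (hm : m ≠ 0) (p : HyperellipticCurve f m) : pw p = 0 ↔ f (pz p) = 0 := by
  rw [← pw_pow p, pow_eq_zero_iff hm]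

/-- A map to the curve is continuous once its first coordinate is, and its second coordinate is
continuous away from the cone points. -/
lemma continuousAt_of_proj {Y : Type*} [TopologicalSpace Y] (hf : Continuous f) (hm : m ≠ 0)
    {F : Y → HyperellipticCurve f m} {y : Y} (hz : ContinuousAt (fun y => pz (F y)) y)
    (hw : pw (F y) ≠ 0 → ContinuousAt (fun y => pw (F y)) y) : ContinuousAt F y := by
  have hi : Topology.IsInducing (fun p : HyperellipticCurve f m => (pz p, pw p)) :=
    Topology.IsInducing.subtypeVal
  refine hi.continuousAt_iff.2 (hz.prodMk ?_)
  -- At a cone point continuity of `w` is automatic: `w ^ m = f z` tends to `0`.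
  by_cases h : pw (F y) = 0
  · refine continuousAt_of_pow (m := m) ?_ h hm
    simp only [pw_pow]
    exact hf.continuousAt.comp hz
  · exact hw h

/-- Lifting a homeomorphism `g` of the plane to the curve, given an `m`-th root `u` of
`(f ∘ g) / f`. -/
noncomputable def liftHomeomorph (hf : Continuous f) (hm : m ≠ 0) (g : ℂ ≃ₜ ℂ) (u : ℂ → ℂ)
    (hu0 : ∀ z, u z ≠ 0) (hu : ∀ z, f z ≠ 0 → ContinuousAt u z)
    (hfu : ∀ z, f z * u z ^ m = f (g z)) :
    HyperellipticCurve f m ≃ₜ HyperellipticCurve f m where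
  toFun p := ⟨(g (pz p), pw p * u (pz p)), by simp only [mul_pow, pw_pow, hfu]⟩
  invFun p := ⟨(g.symm (pz p), pw p / u (g.symm (pz p))), by
    have h := hfu (g.symm (pz p))
    rw [g.apply_symm_apply] at h
    simp only [div_pow, pw_pow]
    rw [div_eq_iff (pow_ne_zero _ (hu0 _)), h]⟩
  left_inv p := by
    refine Subtype.ext (Prod.ext ?_ ?_)
    · exact g.symm_apply_apply _
    · change pw p * u (pz p) / u (g.symm (g (pz p))) = pw p
      rw [g.symm_apply_apply, mul_div_cancel_right₀ _ (hu0 _)]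
  right_inv p := by
    refine Subtype.ext (Prod.ext ?_ ?_)
    · exact g.apply_symm_apply _
    · exact div_mul_cancel₀ _ (hu0 _)
  continuous_toFun := by
    refine continuous_iff_continuousAt.2 fun p =>
      continuousAt_of_proj hf hm (g.continuous.comp continuous_pz).continuousAt fun hp => ?_
    refine continuous_pw.continuousAt.mul ((hu _ ?_).comp continuous_pz.continuousAt)
    rw [Ne, ← pw_eq_zero_iff hm]
    exact left_ne_zero_of_mul hp
  continuous_invFun := by
    refine continuous_iff_continuousAt.2 fun p =>
      continuousAt_of_proj hf hm (g.symm.continuous.comp continuous_pz).continuousAt fun hp => ?_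
    refine continuous_pw.continuousAt.div (ContinuousAt.comp (f := fun p => g.symm (pz p)) (hu _ ?_)
      (g.symm.continuous.comp continuous_pz).continuousAt) (hu0 _)
    exact fun h => hp ((pw_eq_zero_iff hm _).2 h)

/-- The charts are restrictions of `pz`, so the lift inherits the linear part `A`; it preserves cone
points because `u` never vanishes. -/
lemma mem_veech_of_lift (hf : Continuous f) (hm : 2 ≤ m) (A : Matrix.GLPos (Fin 2) ℝ) (c : ℂ)
    (u : ℂ → ℂ) (hu0 : ∀ z, u z ≠ 0) (hu : ∀ z, f z ≠ 0 → ContinuousAt u z)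
    (hfu : ∀ z, f z * u z ^ m = f (affineAbout A c z)) : A ∈ veech f m hf hm := by
  let h := liftHomeomorph hf (by omega : m ≠ 0) (affineAbout A c) u hu0 hu hfu
  have key : ∀ x ∉ (translationStructure f m hf hm).cone,
      (translationStructure f m hf hm).IsAffineAt h A x := by
    intro x _ φ hφ ψ hψ hx hx'
    refine ⟨c - matAct (glMat A) c, ?_⟩
    filter_upwards [φ.open_source.mem_nhds hx,
      h.continuous.continuousAt (ψ.open_source.mem_nhds hx')] with y h1 h2
    rw [hφ.2 y h1, hψ.2 _ h2]
    change c + matAct (glMat A) (pz y - c) = _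
    rw [map_sub]
    ring
  refine ⟨h, ⟨fun x => ?_, fun x hx => ⟨A, key x hx⟩⟩, key⟩
  change pw x * u (pz x) = 0 ↔ pw x = 0
  simp [hu0]

/-- A linear map that fixes pointwise a line and preserves the (co-oriented) family of its
parallels lies in the Veech group if all zeros of `f` are on one of these parallels. -/
lemma mem_veech_of_fix_line (hf : Continuous f) (hm : 2 ≤ m) (A : Matrix.GLPos (Fin 2) ℝ) (c : ℂ)
    (l : ℂ →ₗ[ℝ] ℝ) (s : ℝ) (hs : 0 < s) (hl : ∀ x, l (matAct (glMat A) x) = s * l x)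
    (hfix : ∀ x, l x = 0 → matAct (glMat A) x = x) (hZ : ∀ z, f z = 0 → l (z - c) = 0) :
    A ∈ veech f m hf hm := by
  -- Straight-line homotopy from the identity to `affineAbout A c`.
  let G : ℝ → ℂ → ℂ := fun t z => z + t • (matAct (glMat A) (z - c) - (z - c))
  have hG : Continuous fun q : ℝ × ℂ => G q.1 q.2 := by
    have := continuous_matAct (glMat A)
    simp only [G]
    fun_prop
  have hG0 : ∀ z, G 0 z = z := fun z => by simp [G]
  have hG1 : ∀ z, G 1 z = affineAbout A c z := fun z => by
    simp only [G, affineAbout_apply, one_smul]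
    ring
  have hGfix : ∀ t z, l (z - c) = 0 → G t z = z := fun t z h => by
    simp only [G, hfix _ h, sub_self, smul_zero, add_zero]
  -- `G t` multiplies `l (z - c)` by `1 - t + t * s > 0`. A point sent to a zero is thus on the line
  -- already, where `G t` is the identity.
  have hGne : ∀ t ∈ Icc (0 : ℝ) 1, ∀ z, f z ≠ 0 → f (G t z) ≠ 0 := by
    intro t ht z hz h
    have h1 := hZ _ h
    have h2 : G t z - c = (z - c) + t • (matAct (glMat A) (z - c) - (z - c)) := by
      simp only [G]; ring
    rw [h2, map_add, map_smul, map_sub l (matAct _ _), hl, smul_eq_mul] at h1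
    have h3 : (1 - t + t * s) * l (z - c) = 0 := by linear_combination h1
    have h4 : 0 < 1 - t + t * s := by
      rcases eq_or_lt_of_le ht.1 with rfl | h5
      · simp
      · nlinarith [ht.2, mul_pos h5 hs]
    rw [hGfix t z ((mul_eq_zero.1 h3).resolve_left h4.ne')] at h
    exact hz h
  -- The homotopy `f (G t z) / f z` starts at the constant `1 = exp 0`. Lifting it through `exp`
  -- gives a logarithm at `t = 1`, although the domain need not be simply connected.
  let H : C(unitInterval × {z // f z ≠ 0}, {z : ℂ // z ≠ 0}) :=
    ⟨fun q => ⟨f (G q.1 q.2) / f q.2, div_ne_zero (hGne _ q.1.2 _ q.2.2) q.2.2⟩, by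
      refine Continuous.subtype_mk (Continuous.div ?_ ?_ fun q => q.2.2) _
      · exact hf.comp (hG.comp (by fun_prop : Continuous fun q : unitInterval × {z // f z ≠ 0} =>
          ((q.1 : ℝ), (q.2 : ℂ))))
      · exact hf.comp (continuous_subtype_val.comp continuous_snd)⟩
  have H0 : ∀ a, H (0, a) = (fun z : ℂ => (⟨_, z.exp_ne_zero⟩ : {z : ℂ // z ≠ 0}))
      ((ContinuousMap.const _ 0 : C({z // f z ≠ 0}, ℂ)) a) := by
    intro a
    refine Subtype.ext ?_
    simp [H, hG0, div_self a.2]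
  let L := Complex.isCoveringMap_exp.liftHomotopy H (ContinuousMap.const _ 0) H0
  have hL : ∀ z (hz : f z ≠ 0), Complex.exp (L (1, ⟨z, hz⟩)) = f (affineAbout A c z) / f z :=
    fun z hz => by
      have h := congrArg Subtype.val
        (congrFun (Complex.isCoveringMap_exp.liftHomotopy_lifts H _ H0) (1, ⟨z, hz⟩))
      refine h.trans ?_
      simp [H, hG1]
  have hm0 : m ≠ 0 := by omega
  classical
  -- The value `1` at the zeros is arbitrary but nonzero: these points are fixed, so both sides of
  -- the root equation vanish there.
  let u : ℂ → ℂ := fun z => if hz : f z ≠ 0 then Complex.exp (L (1, ⟨z, hz⟩) / m) else 1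
  refine mem_veech_of_lift hf hm A c u (fun z => ?_) (fun z hz => ?_) fun z => ?_
  · simp only [u]
    split_ifs
    · exact Complex.exp_ne_zero _
    · exact one_ne_zero
  · have ho : IsOpen {z | f z ≠ 0} := isOpen_ne_fun hf continuous_const
    refine ContinuousOn.continuousAt (s := {z | f z ≠ 0}) ?_ (ho.mem_nhds hz)
    rw [continuousOn_iff_continuous_domRestrict]
    have : {z | f z ≠ 0}.domRestrict u = fun z => Complex.exp (L (1, z) / m) := by
      ext z
      exact dif_pos z.2
    rw [this]
    fun_prop
  · by_cases hz : f z = 0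
    · rw [← hG1, hGfix _ _ (hZ z hz), hz, zero_mul]
    · have : u z = Complex.exp (L (1, ⟨z, hz⟩) / m) := dif_pos hz
      rw [this, ← Complex.exp_nat_mul, mul_div_cancel₀ _ (Nat.cast_ne_zero.2 hm0), hL,
        mul_div_cancel₀ _ hz]

/-! ### Saddle connections and segments between zeros -/

/-- A saddle connection projects to a segment between two zeros of `f`. -/
lemma pz_saddleConnection (hf : Continuous f) (hm : 2 ≤ m) {γ : ℝ → HyperellipticCurve f m} {v : ℂ}
    (hγ : (translationStructure f m hf hm).IsSaddleConnection γ v) :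
    pz (γ 1) = pz (γ 0) + v := by
  -- Deviation from uniform motion: locally constant inside the interval, and constant up to the
  -- endpoints by continuity.
  let k : ℝ → ℂ := fun t => pz (γ t) - (t : ℂ) * v
  have hk : ContinuousOn k (Icc 0 1) :=
    (continuous_pz.comp_continuousOn hγ.continuousOn).sub (by fun_prop)
  have hloc : ∀ t ∈ Ioo (0 : ℝ) 1, ∀ᶠ s in 𝓝 t, k s = k t := by
    intro t ht
    obtain ⟨φ, hφ, hx⟩ := (translationStructure f m hf hm).exists_chart _ (hγ.interior t ht)
    have hc : ContinuousAt γ t := hγ.continuousOn.continuousAt (Icc_mem_nhds ht.1 ht.2)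
    filter_upwards [hγ.straight t ht φ hφ hx, hc (φ.open_source.mem_nhds hx)] with s h1 h2
    rw [hφ.2 _ h2, hφ.2 _ hx] at h1
    simp only [k, h1]
    push_cast
    ring
  have hconst : ∀ t ∈ Ioo (0 : ℝ) 1, k t = k (1 / 2) := by
    intro t ht
    refine isOpen_Ioo.is_const_of_deriv_eq_zero isPreconnected_Ioo
      (f := k) (fun s hs => ?_) (fun s hs => ?_) ht (by norm_num)
    · exact ((hasDerivAt_const s (k s)).congr_of_eventuallyEq
        (hloc s hs)).differentiableAt.differentiableWithinAt
    · exact ((hasDerivAt_const s (k s)).congr_of_eventuallyEq (hloc s hs)).deriv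
  have hall : EqOn k (fun _ => k (1 / 2)) (Icc 0 1) := by
    refine EqOn.of_subset_closure (s := Ioo 0 1) hconst hk continuousOn_const Ioo_subset_Icc_self ?_
    rw [closure_Ioo zero_ne_one]
  have h0 := hall (left_mem_Icc.2 zero_le_one)
  have h1 := hall (right_mem_Icc.2 zero_le_one)
  have h2 : k 1 = k 0 := h1.trans h0.symm
  simp only [k, Complex.ofReal_one, Complex.ofReal_zero, one_mul, zero_mul, sub_zero] at h2
  linear_combination h2

/-- Every holonomy vector is the difference of two zeros of `f`. -/
lemma exists_sub_of_mem_hol (hf : Continuous f) (hm : 2 ≤ m) {u : ℂ} (hu : u ∈ hol f m hf hm) :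
    ∃ a b, f a = 0 ∧ f b = 0 ∧ u = b - a := by
  obtain ⟨γ, v, hγ, huv⟩ := hu
  have h0 := (pw_eq_zero_iff (by omega : m ≠ 0) (γ 0)).1 hγ.left_mem
  have h1 := (pw_eq_zero_iff (by omega : m ≠ 0) (γ 1)).1 hγ.right_mem
  have h := pz_saddleConnection hf hm hγ
  rcases huv with rfl | rfl
  · exact ⟨_, _, h0, h1, by rw [h]; ring⟩
  · exact ⟨_, _, h1, h0, by rw [h]; ring⟩

/-- A segment that joins two zeros of `f` and has no zero in its interior lifts to a saddle
connection. -/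
lemma mem_hol_of_segment (hf : Continuous f) (hm : 2 ≤ m) {a v : ℂ} (ha : f a = 0)
    (hb : f (a + v) = 0) (hint : ∀ t ∈ Ioo (0 : ℝ) 1, f (a + (t : ℂ) * v) ≠ 0) :
    v ∈ hol f m hf hm := by
  have hm0 : m ≠ 0 := by omega
  let k : ℝ → ℂ := fun t => f (a + (t : ℂ) * v)
  have hk : Continuous k := hf.comp (by fun_prop)
  have hsc : IsSimplyConnected (Ioo (0 : ℝ) 1) := by
    have := (convex_Ioo (0 : ℝ) 1).contractibleSpace (nonempty_Ioo.2 one_pos)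
    exact (inferInstance : SimplyConnectedSpace (Ioo (0 : ℝ) 1))
  -- The root is continuous only on the open interval. At the endpoints `w ^ m = 0`, and
  -- `continuousAt_of_proj` supplies continuity.
  obtain ⟨w, hw, hwk⟩ := Complex.exists_continuousOn_pow_eq (U := Ioo (0 : ℝ) 1)
    hsc isOpen_Ioo hk.continuousOn
    (by rintro ⟨t, ht, h⟩; exact hint t ht h) hm0
  let γ : ℝ → HyperellipticCurve f m := fun t => ⟨(a + (t : ℂ) * v, w t), hwk t⟩
  have hz : ∀ t, pz (γ t) = a + (t : ℂ) * v := fun t => rfl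
  have h0 : pw (γ 0) = 0 := (pw_eq_zero_iff hm0 _).2 (by simpa [hz] using ha)
  have h1 : pw (γ 1) = 0 := (pw_eq_zero_iff hm0 _).2 (by simpa [hz] using hb)
  have hγ : ∀ t ∈ Icc (0 : ℝ) 1, ContinuousAt γ t := by
    intro t ht
    refine continuousAt_of_proj hf hm0 (by simp only [hz]; fun_prop) fun hne => ?_
    refine hw.continuousAt (Ioo_mem_nhds (lt_of_le_of_ne ht.1 ?_) (lt_of_le_of_ne ht.2 ?_))
    · rintro rfl; exact hne h0
    · rintro rfl; exact hne h1
  refine ⟨γ, v, ⟨?_, h0, h1, fun t ht h => ?_, fun t ht φ hφ hx => ?_⟩, Or.inl rfl⟩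
  · exact fun t ht => (hγ t ht).continuousWithinAt
  · exact hint t ht ((pw_eq_zero_iff hm0 _).1 h)
  · filter_upwards [(hγ t (Ioo_subset_Icc_self ht)) (φ.open_source.mem_nhds hx)] with s hs
    rw [hφ.2 _ hs, hφ.2 _ hx, hz, hz]
    push_cast
    ring

end HyperellipticCurve

/-! ### Rotations and shears -/

lemma matAct_rotationGL (θ : ℝ) (z : ℂ) :
    matAct (glMat (rotationGL θ)) z = Complex.exp (θ * Complex.I) * z := by
  have h : glMat (rotationGL θ) = !![Real.cos θ, -Real.sin θ; Real.sin θ, Real.cos θ] := rfl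
  rw [h, matAct_apply, Complex.exp_mul_I, ← Complex.ofReal_cos, ← Complex.ofReal_sin]
  apply Complex.ext <;> simp [-Complex.ofReal_cos, -Complex.ofReal_sin] <;> ring

/-- The shear `(1 t; 0 1)`. -/
noncomputable def shearGL (t : ℝ) : Matrix.GLPos (Fin 2) ℝ :=
  ⟨Matrix.GeneralLinearGroup.mkOfDetNeZero !![1, t; 0, 1] (by simp), by
    rw [Matrix.mem_glpos]
    change 0 < (!![1, t; 0, 1] : Matrix (Fin 2) (Fin 2) ℝ).det
    simp⟩

lemma glMat_shearGL (t : ℝ) : glMat (shearGL t) = !![1, t; 0, 1] := rfl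

lemma shearGL_mem (t : ℝ) : shearGL t ∈ groupP := ⟨t, 1, one_pos, glMat_shearGL t⟩

lemma shearGL_injective : Function.Injective shearGL := fun s t h => by
  have h1 : glMat (shearGL s) 0 1 = glMat (shearGL t) 0 1 := by rw [h]
  simpa [glMat_shearGL] using h1

/-! ### Size of the Veech group -/

namespace HyperellipticCurve

variable {f : ℂ → ℂ} {m : ℕ}

/-- If the zeros of `f` lie on a line, the Veech group contains a conjugate of `P` by a
rotation. -/
lemma exists_rotation_conj_mem_veech (hf : Continuous f) (hm : 2 ≤ m) {c d : ℂ}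
    (hZ : ∀ z, f z = 0 → ∃ r : ℝ, z = r • d + c) :
    ∃ θ : ℝ, ∀ A ∈ groupP, (rotationGL θ)⁻¹ * A * rotationGL θ ∈ veech f m hf hm := by
  -- This rotation turns the line's direction `d` to the real axis, which `P` fixes pointwise while
  -- scaling imaginary parts by `s > 0`.
  refine ⟨-d.arg, ?_⟩
  rintro A ⟨t, s, hs, hA⟩
  set R := rotationGL (-d.arg) with hR
  have hRd : matAct (glMat R) d = (‖d‖ : ℂ) := by
    rw [hR, matAct_rotationGL]
    conv_lhs => rw [← Complex.norm_mul_exp_arg_mul_I d]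
    rw [mul_left_comm, ← Complex.exp_add]
    simp
  have hAim : ∀ x, (matAct (glMat A) x).im = s * x.im := fun x => by
    rw [hA, matAct_apply]; simp
  have hAfix : ∀ x : ℂ, x.im = 0 → matAct (glMat A) x = x := fun x hx => by
    rw [hA, matAct_apply]; apply Complex.ext <;> simp [hx]
  refine mem_veech_of_fix_line hf hm _ c (Complex.imLm ∘ₗ matAct (glMat R)) s hs ?_ ?_ ?_
  · intro x
    simp only [matAct_glMat_mul, LinearMap.comp_apply, matAct_glMat_apply_inv]
    exact hAim _
  · intro x hx
    rw [matAct_glMat_mul, matAct_glMat_mul, hAfix _ hx, matAct_glMat_inv_apply]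
  · intro z hz
    obtain ⟨r, rfl⟩ := hZ z hz
    rw [add_sub_cancel_right, LinearMap.comp_apply, map_smul, hRd]
    simp

/-- The conjugated shears already form a family injectively indexed by `ℝ`. -/
lemma not_countable_veech (hf : Continuous f) (hm : 2 ≤ m) {θ : ℝ}
    (h : ∀ A ∈ groupP, (rotationGL θ)⁻¹ * A * rotationGL θ ∈ veech f m hf hm) :
    ¬ (veech f m hf hm : Set (Matrix.GLPos (Fin 2) ℝ)).Countable := by
  intro hc
  have hinj : Function.Injective fun t => (rotationGL θ)⁻¹ * shearGL t * rotationGL θ :=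
    fun s t hst => shearGL_injective (mul_left_cancel (mul_right_cancel hst))
  have h1 := hc.preimage hinj
  rw [preimage_eq_univ_iff.2 (by rintro _ ⟨t, rfl⟩; exact h _ (shearGL_mem t))] at h1
  exact Cardinal.not_countable_real h1

/-- Any ray from a zero of `f` to another one starts with a saddle connection. -/
lemma exists_smul_mem_hol (hf : Continuous f) (hm : 2 ≤ m)
    (hfin : ∀ r : ℝ, {z | f z = 0 ∧ ‖z‖ ≤ r}.Finite) {a b : ℂ} (hab : a ≠ b) (ha : f a = 0)
    (hb : f b = 0) : ∃ t : ℝ, 0 < t ∧ t • (b - a) ∈ hol f m hf hm := by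
  have hba : b - a ≠ 0 := sub_ne_zero.2 hab.symm
  -- Parameters of the zeros on the segment, without the starting point `a`. The segment is bounded,
  -- so `T` is finite; its least element ends the first saddle connection.
  let T : Set ℝ := {t | t ∈ Ioc (0 : ℝ) 1 ∧ f (a + (t : ℂ) * (b - a)) = 0}
  have hT : T.Finite := by
    refine Finite.of_injOn (f := fun t : ℝ => a + (t : ℂ) * (b - a)) ?_ ?_
      (hfin (‖a‖ + ‖b - a‖))
    · rintro t ⟨ht, h⟩
      refine ⟨h, (norm_add_le _ _).trans ?_⟩
      rw [norm_mul, Complex.norm_real, Real.norm_of_nonneg ht.1.le]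
      gcongr
      exact mul_le_of_le_one_left (norm_nonneg _) ht.2
    · intro s _ t _ h
      simpa [hba] using h
  obtain ⟨t, ⟨ht, htf⟩, hmin⟩ := exists_min_image T id hT
    ⟨1, ⟨one_pos, le_rfl⟩, by simpa using hb⟩
  refine ⟨t, ht.1, mem_hol_of_segment hf hm ha ?_ fun s hs h => ?_⟩
  · rwa [Complex.real_smul]
  · have hst : s * t < t := mul_lt_of_lt_one_left ht.1 hs.2
    have hmem : s * t ∈ T := by
      refine ⟨⟨mul_pos hs.1 ht.1, hst.le.trans ht.2⟩, ?_⟩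
      rw [Complex.real_smul, ← mul_assoc] at h
      exact_mod_cast h
    exact absurd (hmin _ hmem) (not_le.2 hst)

lemma countable_hol (hf : Continuous f) (hm : 2 ≤ m) (hc : {z | f z = 0}.Countable) :
    (hol f m hf hm).Countable := by
  refine ((hc.prod hc).image fun q => q.2 - q.1).mono fun u hu => ?_
  obtain ⟨a, b, ha, hb, rfl⟩ := exists_sub_of_mem_hol hf hm hu
  exact ⟨(a, b), ⟨ha, hb⟩, rfl⟩

/-- If the zeros of `f` lie on a line, all holonomy vectors are parallel to it, so that the
quarter turn is not in the Veech group. -/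
lemma veech_ne_top (hf : Continuous f) (hm : 2 ≤ m) {c d : ℂ}
    (hZ : ∀ z, f z = 0 → ∃ r : ℝ, z = r • d + c) {u : ℂ} (hu0 : u ≠ 0) (hu : u ∈ hol f m hf hm) :
    veech f m hf hm ≠ ⊤ := by
  intro htop
  have hpar : ∀ v ∈ hol f m hf hm, ∃ r : ℝ, v = (r : ℂ) * d := by
    intro v hv
    obtain ⟨a, b, ha, hb, rfl⟩ := exists_sub_of_mem_hol hf hm hv
    obtain ⟨r, rfl⟩ := hZ a ha
    obtain ⟨s, rfl⟩ := hZ b hb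
    exact ⟨s - r, by simp only [Complex.real_smul]; push_cast; ring⟩
  have hrot : rotationGL (Real.pi / 2) ∈ veech f m hf hm := by rw [htop]; trivial
  obtain ⟨s, hs⟩ := hpar _ (TranslationStructure.matAct_mem_holonomyVectors _ hrot hu)
  obtain ⟨r, rfl⟩ := hpar u hu
  have hd : d ≠ 0 := right_ne_zero_of_mul hu0
  rw [matAct_rotationGL, Complex.ofReal_div, Complex.ofReal_ofNat, Complex.exp_pi_div_two_mul_I,
    ← mul_assoc] at hs
  -- After cancelling `d`, `hs` equates `I * r` with the real number `s`, forcing `r = 0`.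
  have h := congrArg Complex.im (mul_right_cancel₀ hd hs)
  simp only [Complex.mul_im, Complex.I_re, Complex.I_im, Complex.ofReal_re, Complex.ofReal_im,
    zero_mul, one_mul, zero_add] at h
  simp [h] at hu0

lemma mapsTo_and_injOn_veech (hf : Continuous f) (hm : 2 ≤ m) {u v : ℂ} (hu : u ∈ hol f m hf hm)
    (hv : v ∈ hol f m hf hm) (huv : LinearIndependent ℝ ![u, v]) :
    MapsTo (fun A => (matAct (glMat A) u, matAct (glMat A) v)) (veech f m hf hm)
      (hol f m hf hm ×ˢ hol f m hf hm) ∧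
    InjOn (fun A => (matAct (glMat A) u, matAct (glMat A) v)) (veech f m hf hm) := by
  refine ⟨fun A hA => ⟨TranslationStructure.matAct_mem_holonomyVectors _ hA hu,
    TranslationStructure.matAct_mem_holonomyVectors _ hA hv⟩, fun A _ B _ h => ?_⟩
  exact matAct_glMat_injective
    (matAct_eq_of_linearIndependent huv (congrArg Prod.fst h) (congrArg Prod.snd h))

lemma exists_linearIndependent_mem_hol (hf : Continuous f) (hm : 2 ≤ m)
    (hfin : ∀ r : ℝ, {z | f z = 0 ∧ ‖z‖ ≤ r}.Finite) {a b : ℂ} (hab : a ≠ b) (ha : f a = 0)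
    (hb : f b = 0) (hcol : ¬ Collinear ℝ {z | f z = 0}) :
    ∃ u ∈ hol f m hf hm, ∃ v ∈ hol f m hf hm, LinearIndependent ℝ ![u, v] := by
  rw [collinear_iff_of_mem (p₀ := a) ha] at hcol
  push Not at hcol
  obtain ⟨p, hp, hpr⟩ := hcol (b - a)
  have hba : b - a ≠ 0 := sub_ne_zero.2 hab.symm
  have hap : a ≠ p := fun h => hpr 0 (by simp [h])
  obtain ⟨s, hs, hsu⟩ := exists_smul_mem_hol hf hm hfin hab ha hb
  obtain ⟨t, ht, htv⟩ := exists_smul_mem_hol hf hm hfin hap ha hp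
  refine ⟨_, hsu, _, htv, (LinearIndependent.pair_iff' (smul_ne_zero hs.ne' hba)).2 ?_⟩
  intro r h
  -- A relation `r • s • (b - a) = t • (p - a)` would put `p` on the line through `a` and `b`.
  refine hpr (t⁻¹ * (r * s)) ?_
  rw [mul_smul, mul_smul, h, inv_smul_smul₀ ht.ne', vadd_eq_add, sub_add_cancel]

end HyperellipticCurve

namespace IsWeierstrassFunction

variable {f : ℂ → ℂ} {Z : ℕ → ℂ}

lemma setOf_eq_zero (hf : IsWeierstrassFunction f Z) : {z | f z = 0} = range Z :=
  Set.ext hf.zero_iff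

lemma finite_zeros_norm_le (hf : IsWeierstrassFunction f Z)
    (hZ : Tendsto (fun k => ‖Z k‖) atTop atTop) (r : ℝ) : {z | f z = 0 ∧ ‖z‖ ≤ r}.Finite := by
  have h : {k | ¬ r < ‖Z k‖}.Finite := by
    have := hZ.eventually_gt_atTop r
    rwa [← Nat.cofinite_eq_atTop, eventually_cofinite] at this
  refine (h.image Z).subset ?_
  rintro z ⟨hz, hzr⟩
  obtain ⟨k, rfl⟩ := (hf.zero_iff z).1 hz
  exact ⟨k, not_lt.2 hzr, rfl⟩

end IsWeierstrassFunction

theorem theoremt (Z : ℕ → ℂ) (hZ_inj : Function.Injective Z)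
    (hZ_lim : Tendsto (fun k => ‖Z k‖) atTop atTop)
    (f : ℂ → ℂ) (hf : IsWeierstrassFunction f Z) (m : ℕ) (hm : 2 ≤ m) :
    ((¬ (HyperellipticCurve.veech f m hf.differentiable.continuous hm : Set (Matrix.GLPos (Fin 2) ℝ)).Countable ∧
        HyperellipticCurve.veech f m hf.differentiable.continuous hm ≠ ⊤) ↔ Collinear ℝ (range Z)) ∧
    (Collinear ℝ (range Z) → ∃ θ : ℝ, ∀ A ∈ groupP,
      (rotationGL θ)⁻¹ * A * rotationGL θ ∈ HyperellipticCurve.veech f m hf.differentiable.continuous hm) ∧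
    (¬ Collinear ℝ (range Z) →
      (HyperellipticCurve.hol f m hf.differentiable.continuous hm ×ˢ HyperellipticCurve.hol f m hf.differentiable.continuous hm).Countable ∧
      (∃ u ∈ HyperellipticCurve.hol f m hf.differentiable.continuous hm, ∃ v ∈ HyperellipticCurve.hol f m hf.differentiable.continuous hm,
        LinearIndependent ℝ ![u, v]) ∧
      ∀ u ∈ HyperellipticCurve.hol f m hf.differentiable.continuous hm, ∀ v ∈ HyperellipticCurve.hol f m hf.differentiable.continuous hm,
        LinearIndependent ℝ ![u, v] →
        MapsTo (fun A => (matAct (glMat A) u, matAct (glMat A) v))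
          (HyperellipticCurve.veech f m hf.differentiable.continuous hm)
          (HyperellipticCurve.hol f m hf.differentiable.continuous hm ×ˢ HyperellipticCurve.hol f m hf.differentiable.continuous hm) ∧
        InjOn (fun A => (matAct (glMat A) u, matAct (glMat A) v))
          (HyperellipticCurve.veech f m hf.differentiable.continuous hm)) := by
  have hfc := hf.differentiable.continuous
  have hfin := hf.finite_zeros_norm_le hZ_lim
  have hZ0 : ∀ k, f (Z k) = 0 := fun k => (hf.zero_iff _).2 ⟨k, rfl⟩
  have h01 : Z 0 ≠ Z 1 := hZ_inj.ne zero_ne_one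
  have hline : Collinear ℝ (range Z) → ∃ d : ℂ, ∀ z, f z = 0 → ∃ r : ℝ, z = r • d + Z 0 := by
    intro h
    obtain ⟨d, hd⟩ := (collinear_iff_of_mem (mem_range_self 0)).1 h
    exact ⟨d, fun z hz => hd z ((hf.zero_iff z).1 hz)⟩
  have hind : ¬ Collinear ℝ (range Z) → ∃ u ∈ HyperellipticCurve.hol f m hfc hm, ∃ v ∈ HyperellipticCurve.hol f m hfc hm,
      LinearIndependent ℝ ![u, v] := fun h =>
    HyperellipticCurve.exists_linearIndependent_mem_hol hfc hm hfin h01 (hZ0 0) (hZ0 1) (by rwa [hf.setOf_eq_zero])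
  have hcount : (HyperellipticCurve.hol f m hfc hm ×ˢ HyperellipticCurve.hol f m hfc hm).Countable := by
    have h := HyperellipticCurve.countable_hol hfc hm (by rw [hf.setOf_eq_zero]; exact countable_range Z)
    exact h.prod h
  refine ⟨⟨fun ⟨hunc, _⟩ => ?_, fun h => ?_⟩, fun h => ?_, fun h => ?_⟩
  · by_contra hcol
    obtain ⟨u, hu, v, hv, huv⟩ := hind hcol
    obtain ⟨hmaps, hinj⟩ := HyperellipticCurve.mapsTo_and_injOn_veech hfc hm hu hv huv
    exact hunc (hmaps.countable_of_injOn hinj hcount)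
  · obtain ⟨d, hd⟩ := hline h
    obtain ⟨θ, hθ⟩ := HyperellipticCurve.exists_rotation_conj_mem_veech hfc hm hd
    obtain ⟨t, ht, hu⟩ := HyperellipticCurve.exists_smul_mem_hol hfc hm hfin h01 (hZ0 0) (hZ0 1)
    exact ⟨HyperellipticCurve.not_countable_veech hfc hm hθ,
      HyperellipticCurve.veech_ne_top hfc hm hd (smul_ne_zero ht.ne' (sub_ne_zero.2 h01.symm)) hu⟩
  · obtain ⟨d, hd⟩ := hline h
    exact HyperellipticCurve.exists_rotation_conj_mem_veech hfc hm hd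
  · exact ⟨hcount, hind h, fun u hu v hv huv => HyperellipticCurve.mapsTo_and_injOn_veech hfc hm hu hv huv⟩
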